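/- **Setting.** A *binary memoryless symmetric (BMS) channel* is a channel $W:\{0,1\}\to\mathcal Y$ with discrete output alphabet $\mathcal Y$ and transition probabilities $W(y|x)$, for which there is a permutation $\pi$ of $\mathcal Y$ with $\pi^{-1}=\pi$ and $W(y|1)=W(\pi(y)|0)$ for all $y\in\mathcal Y$. Let $m\ge 1$ and $[m]=\{1,\dots,m\}$. For $A\subseteq[m]$ let $v_m(A)\in\mathbb F_2^{2^m}$ be the vector with components $v_m(A,z)=\prod_{i\in A}z_i$, $z\in\{0,1\}^m$. Order the subsets of $[m]$ totally by: $A<B$ if $|A|>|B|$, or if $|A|=|B|$ and, writing $A=\{a_1>a_2>\cdots\}$ and $B=\{b_1>b_2>\cdots\}$, there is an $i$ with $a_j=b_j$ for all $j<i$ and $a_i<b_i$. Let $(U_A)_{A\subseteq[m]}$ be i.i.d. Bernoulli-$1/2$ random variables, let $X=(X_z)_{z\in\{0,1\}^m}=\sum_{A\subseteq[m]}U_A\,v_m(A)$ over $\mathbb F_2$, and let $Y=(Y_z)_{z\in\{0,1\}^m}$ be the outputs when the components $X_z$ are sent through $2^m$ independent copies of $W$. Put $$H_A^{(m)}=H_A^{(m,W)}:=H\bigl(U_A\,\big|\,Y,\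 (U_B)_{B<A}\bigr),$$ where $H(\cdot|\cdot)$ is conditional entropy in bits. An *increasing chain of sets* is a sequence $\emptyset=A_0\subseteq A_1\subseteq\cdots\subseteq A_m=[m]$ with $|A_i|=i$ for all $i$. **Theorem.** For every $\epsilon>0$ there is a constant $D(\epsilon)$, independent of $m$ and of $W$, such that for every BMS channel $W$, every $m\ge 1$ and every increasing chain of sets $\emptyset=A_0\subseteq A_1\subseteq\cdots\subseteq A_m=[m]$, $$\Bigl|\bigl\{i\in\{0,1,\dots,m\}:\ \epsilon<H_{A_i}^{(m)}<1-\epsilon\bigr\}\Bigr|\le D(\epsilon).$$ -/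

import Mathlib

open scoped ENNReal

universe u

/-! ### Independent channel uses -/

theorem tsum_prod_eq_prod_tsum (ι : Type) [Fintype ι] {Y : Type u} (f : ι → Y → ℝ≥0∞) :
    ∑' y : ι → Y, ∏ i, f i (y i) = ∏ i, ∑' y, f i y := by
  revert f
  refine Fintype.induction_empty_option
    (P := fun ι _ => ∀ f : ι → Y → ℝ≥0∞, ∑' y : ι → Y, ∏ i, f i (y i) = ∏ i, ∑' y, f i y)
    ?_ ?_ ?_ ι
  · intro α β _ e h f
    let _ : Fintype α := Fintype.ofEquiv β e.symm
    have h' := h (fun a => f (e a))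
    rw [← (Equiv.arrowCongr e (Equiv.refl Y)).tsum_eq]
    have e1 : ∀ y : α → Y, ∏ i : β, f i ((Equiv.arrowCongr e (Equiv.refl Y)) y i)
        = ∏ a : α, f (e a) (y a) := by
      intro y
      rw [← e.prod_comp]
      simp
    have e2 : ∏ i : β, ∑' y, f i y = ∏ a : α, ∑' y, f (e a) y :=
      (e.prod_comp (fun i => ∑' y, f i y)).symm
    rw [e2, ← h']
    exact tsum_congr e1
  · intro f
    simp
  · intro α _ h f
    rw [Fintype.prod_option, ← h (fun a => f (some a)),
      ← (Equiv.piOptionEquivProd (β := fun _ : Option α => Y)).symm.tsum_eq, ENNReal.tsum_prod',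
      ← ENNReal.tsum_mul_right]
    refine tsum_congr fun y => ?_
    rw [← ENNReal.tsum_mul_left]
    refine tsum_congr fun z => ?_
    rw [Fintype.prod_option]
    rfl

/-- The law of a family of independent random variables, the `i`-th one with law `p i`. -/
noncomputable def indepLaw {ι : Type} [Fintype ι] {Y : Type u} (p : ι → PMF Y) : PMF (ι → Y) :=
  ⟨fun y => ∏ i, p i (y i), by
    have h := tsum_prod_eq_prod_tsum ι (fun i y => p i y)
    simp only [PMF.tsum_coe, Finset.prod_const_one] at h
    exact h ▸ ENNReal.summable.hasSum⟩

/-! ### Channels and conditional entropy -/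

/-- `W x y` is the transition probability `W(y|x)` of a channel with input alphabet `{0, 1}` and
discrete output alphabet `Y`.  The channel is symmetric if some permutation `π` of `Y` with
`π⁻¹ = π` satisfies `W(y|1) = W(π(y)|0)` for all `y`. -/
def IsBMS {Y : Type u} (W : ZMod 2 → PMF Y) : Prop :=
  ∃ π : Equiv.Perm Y, π⁻¹ = π ∧ ∀ y, W 1 y = W 0 (π y)

/-- The conditional entropy `H(X | Z) = - ∑ P(x, z) log₂ P(x | z)`, in bits, of discrete random
variables `X`, `Z` on a discrete probability space with law `p`, where `X` is finitely valued. -/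
noncomputable def condEntropy {Ω : Type u} {S T : Type*} [Fintype S]
    (p : PMF Ω) (X : Ω → S) (Z : Ω → T) : ℝ :=
  ∑' z : T, ∑ x : S,
    -(((p.map fun ω => (X ω, Z ω)) (x, z)).toReal *
      Real.logb 2 (((p.map fun ω => (X ω, Z ω)) (x, z)).toReal / ((p.map Z) z).toReal))

/-! ### Reed-Muller codes -/

/-- The order in which the rows are processed: `A < B` if `|A| > |B|`, or if `|A| = |B|` and,
with the elements of both sets listed in decreasing order, the list of `A` precedes that of `B`
lexicographically. -/
def rowLT {m : ℕ} (A B : Finset (Fin m)) : Prop :=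
  B.card < A.card ∨ (A.card = B.card ∧ A.sort (· ≥ ·) < B.sort (· ≥ ·))

/-- The row `v_m(A)`: the evaluations at all `z ∈ {0,1}^m` of the monomial `∏_{i ∈ A} Z_i`. -/
def rmRow {m : ℕ} (A : Finset (Fin m)) (z : Fin m → ZMod 2) : ZMod 2 :=
  ∏ i ∈ A, z i

/-- The encoder `X = ∑_A U_A v_m(A)` over the field with two elements. -/
def rmEncode {m : ℕ} (U : Finset (Fin m) → ZMod 2) (z : Fin m → ZMod 2) : ZMod 2 :=
  ∑ A : Finset (Fin m), U A * rmRow A z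

/-- The joint law of `(U, Y)`: the bits `U_A`, `A ⊆ [m]`, are i.i.d. uniform, and the `2^m`
components of `X = ∑_A U_A v_m(A)` are sent through independent copies of `W`, with outputs
`Y_z`, `z ∈ {0,1}^m`. -/
noncomputable def rmLaw {Y : Type u} (W : ZMod 2 → PMF Y) (m : ℕ) :
    PMF ((Finset (Fin m) → ZMod 2) × ((Fin m → ZMod 2) → Y)) :=
  (PMF.uniformOfFintype (Finset (Fin m) → ZMod 2)).bind fun U =>
    (indepLaw fun z => W (rmEncode U z)).map fun y => (U, y)

/-- `H_A^{(m)} = H(U_A | Y, (U_B)_{B < A})`. -/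
noncomputable def rmEntropy {Y : Type u} (W : ZMod 2 → PMF Y) (m : ℕ) (A : Finset (Fin m)) : ℝ :=
  condEntropy (rmLaw W m) (fun ω => ω.1 A)
    (fun ω => (ω.2, fun B : {B : Finset (Fin m) // rowLT B A} => ω.1 B.1))

/-- An increasing chain `∅ = A₀ ⊆ A₁ ⊆ ⋯ ⊆ A_m = [m]` of sets with `|A_i| = i`. -/
def IsIncreasingChain {m : ℕ} (A : Fin (m + 1) → Finset (Fin m)) : Prop :=
  Monotone A ∧ ∀ i, (A i).card = (i : ℕ)

/-! Along a chain the entropies never decrease, and each step from a value in `(ε, 1 - ε)` raises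
them by at least `entropyGap ε`, which depends only on `ε`. Since they stay in `[0, 1]`, only
boundedly many can lie in the middle.

For one step `C → C ∪ {x}`, split the code in `m + 1` variables by the value of `z_x`. The
restrictions to `z_x = 0` and `z_x = 1` are independent copies of the code in `m` variables
(`rmLaw_map_rmSplit`), with coefficients `U_C` and `U_C + U_{C ∪ x}`. With `H⁻` the entropy of the
sum of the two copies of the bit `U_C`, given both observations, `H_C^{(m+1)} ≤ H_C^{(m)} ≤ H⁻ ≤
H_{C ∪ x}^{(m+1)}`. The outer inequalities hold because conditioning on more reduces entropy, and
rest on the compatibility of `rowLT` with adding and removing `x`.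

The middle inequality is quantitative. Conditional biases multiply when independent bits are added,
and the strong concavity of binary entropy gives `H⁻ - H ≥ q (1 - q) / (2 log 2)`, where `q` is the
second moment of the conditional bias. An entropy away from `0` and `1` keeps `q` away from `1` and
`0`. -/

/-! ### Binary entropy as a function of the bias -/

/-- The entropy in bits of a bit `b` with bias `P(b = 0) - P(b = 1) = s`. -/
noncomputable def biasEntropy (s : ℝ) : ℝ := Real.binEntropy ((1 - s) / 2) / Real.log 2

theorem biasEntropy_neg (s : ℝ) : biasEntropy (-s) = biasEntropy s := by
  unfold biasEntropy
  rw [← Real.binEntropy_one_sub]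
  congr 2
  ring

theorem biasEntropy_nonneg {s : ℝ} (hs : |s| ≤ 1) : 0 ≤ biasEntropy s := by
  obtain ⟨h₁, h₂⟩ := abs_le.1 hs
  exact div_nonneg (Real.binEntropy_nonneg (by linarith) (by linarith))
    (Real.log_nonneg one_le_two)

theorem biasEntropy_le_one (s : ℝ) : biasEntropy s ≤ 1 :=
  (div_le_one (Real.log_pos one_lt_two)).2 Real.binEntropy_le_log_two

/-- By concavity, binary entropy lies above its chord from `0` to `1/2`. -/
theorem one_sub_abs_le_biasEntropy {s : ℝ} (hs : |s| ≤ 1) : 1 - |s| ≤ biasEntropy s := by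
  wlog h : 0 ≤ s generalizing s
  · have := this (s := -s) (by rwa [abs_neg]) (by linarith)
    rwa [abs_neg, biasEntropy_neg] at this
  rw [abs_of_nonneg h] at hs ⊢
  have hc := Real.strictConcave_binEntropy.concaveOn.2 (x := 0) (by simp) (y := 2⁻¹)
    (by norm_num) h (sub_nonneg.2 hs) (by ring)
  simp only [smul_eq_mul, Real.binEntropy_zero, Real.binEntropy_two_inv, mul_zero, zero_add] at hc
  rw [biasEntropy, le_div_iff₀ (Real.log_pos one_lt_two)]
  exact hc.trans_eq (congrArg _ (by ring))

theorem negMulLog_le_sqrt {x : ℝ} (hx : 0 ≤ x) : x.negMulLog ≤ 2 * √x - 2 * x := by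
  rcases hx.eq_or_lt with rfl | hx
  · simp
  have hs : 0 < √x := Real.sqrt_pos.2 hx
  -- This is `log t ≤ t - 1` at `t = 1 / √x`, multiplied by `2 * x`.
  have h := mul_le_mul_of_nonneg_left (Real.log_le_sub_one_of_pos (inv_pos.2 hs))
    (mul_nonneg zero_le_two hx.le)
  rw [Real.log_inv, Real.log_sqrt hx.le] at h
  have e : x * (√x)⁻¹ = √x := by
    rw [← div_eq_mul_inv]; exact Real.div_sqrt
  rw [Real.negMulLog]
  linear_combination h + 2 * e

theorem biasEntropy_le_sqrt {s : ℝ} (hs : |s| ≤ 1) :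
    biasEntropy s ≤ √(1 - s ^ 2) / Real.log 2 := by
  obtain ⟨h₁, h₂⟩ := abs_le.1 hs
  unfold biasEntropy
  refine div_le_div_of_nonneg_right ?_ (Real.log_nonneg one_le_two)
  rw [Real.binEntropy_eq_negMulLog_add_negMulLog_one_sub]
  have hp : 0 ≤ (1 - s) / 2 := by linarith
  have hq : 0 ≤ 1 - (1 - s) / 2 := by linarith
  have hp' := negMulLog_le_sqrt hp
  have hq' := negMulLog_le_sqrt hq
  have e : √(1 - s ^ 2) = 2 * (√((1 - s) / 2) * √(1 - (1 - s) / 2)) := by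
    rw [← Real.sqrt_mul hp, show 1 - s ^ 2 = 2 ^ 2 * ((1 - s) / 2 * (1 - (1 - s) / 2)) by ring,
      Real.sqrt_mul (by norm_num), Real.sqrt_sq zero_le_two]
  rw [e]
  have sp := Real.sq_sqrt hp
  have sq := Real.sq_sqrt hq
  set a := √((1 - s) / 2)
  set b := √(1 - (1 - s) / 2)
  have ha : 0 ≤ a := Real.sqrt_nonneg _
  have hb : 0 ≤ b := Real.sqrt_nonneg _
  -- As `a ^ 2 + b ^ 2 = 1`, the two bounds add up to `2 * (a + b - 1)`, while the target is `2 * a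
  -- * b = (a + b - 1) * (a + b + 1)`.
  have hab : 1 ≤ a + b := by nlinarith [mul_nonneg ha hb]
  nlinarith

/-- The square root is linearised by `2 * √v ≤ l + v / l`. The bound becomes affine in `s ^ 2`, so
it can be averaged over the observations and `l` chosen afterwards. -/
theorem biasEntropy_le_of_pos {s l : ℝ} (hs : |s| ≤ 1) (hl : 0 < l) :
    biasEntropy s ≤ (l + (1 - s ^ 2) / l) / (2 * Real.log 2) := by
  refine (biasEntropy_le_sqrt hs).trans ?_
  have hlog := Real.log_pos one_lt_two
  rw [← div_div]
  refine div_le_div_of_nonneg_right ?_ hlog.le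
  have hs' : 0 ≤ 1 - s ^ 2 := by nlinarith [abs_le.1 hs]
  have := Real.sq_sqrt hs'
  have h : (1 - s ^ 2) / l = √(1 - s ^ 2) ^ 2 / l := by rw [this]
  rw [h, le_div_iff₀ two_pos, ← sub_nonneg]
  have : l + √(1 - s ^ 2) ^ 2 / l - √(1 - s ^ 2) * 2 = (√(1 - s ^ 2) - l) ^ 2 / l := by
    field_simp
    ring
  rw [this]
  positivity

theorem le_biasEntropy_of_pos {s l : ℝ} (hs : |s| ≤ 1) (hl : 0 < l) :
    1 - (l + s ^ 2 / l) / 2 ≤ biasEntropy s := by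
  refine le_trans ?_ (one_sub_abs_le_biasEntropy hs)
  have : l + s ^ 2 / l - 2 * |s| = (|s| - l) ^ 2 / l := by
    rw [← sq_abs]
    field_simp
    ring
  have h : 0 ≤ (|s| - l) ^ 2 / l := by positivity
  linarith

/-- Strong concavity: in nats, the second derivative of binary entropy is `-1 / (p * (1 - p)) ≤ -4`.
-/
theorem concaveOn_binEntropy_add_sq :
    ConcaveOn ℝ (Set.Icc 0 1) fun p : ℝ => Real.binEntropy p + 2 * p ^ 2 := by
  have hd : ∀ p ∈ Set.Ioo (0 : ℝ) 1, HasDerivAt (fun p : ℝ => Real.binEntropy p + 2 * p ^ 2)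
      (Real.log (1 - p) - Real.log p + 4 * p) p := by
    intro p hp
    refine ((Real.hasDerivAt_binEntropy hp.1.ne' hp.2.ne).add
      ((hasDerivAt_pow 2 p).const_mul 2)).congr_deriv ?_
    push_cast
    ring
  have hd2 : ∀ p ∈ Set.Ioo (0 : ℝ) 1,
      HasDerivAt (deriv fun p : ℝ => Real.binEntropy p + 2 * p ^ 2)
      (-1 / (1 - p) - p⁻¹ + 4) p := by
    intro p hp
    have h : HasDerivAt (fun p : ℝ => Real.log (1 - p) - Real.log p + 4 * p)
        (-1 / (1 - p) - p⁻¹ + 4) p := by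
      have h1 := ((hasDerivAt_id' p).const_sub 1).log (sub_pos.2 hp.2).ne'
      have h2 := Real.hasDerivAt_log hp.1.ne'
      have h3 := (hasDerivAt_id' p).const_mul 4
      exact ((h1.sub h2).add h3).congr_deriv (by rw [mul_one])
    refine h.congr_of_eventuallyEq ?_
    filter_upwards [isOpen_Ioo.mem_nhds hp] with q hq using (hd q hq).deriv
  refine concaveOn_of_deriv2_nonpos (convex_Icc 0 1) (by fun_prop) ?_ ?_ ?_
  · rw [interior_Icc]
    exact fun p hp => (hd p hp).differentiableAt.differentiableWithinAt
  · rw [interior_Icc]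
    exact fun p hp => (hd2 p hp).differentiableAt.differentiableWithinAt
  · rw [interior_Icc]
    intro p hp
    rw [Function.iterate_succ, Function.iterate_one, Function.comp_apply, (hd2 p hp).deriv]
    have h1 := sub_pos.2 hp.2
    have h0 := hp.1
    have : -1 / (1 - p) - p⁻¹ + 4 = -((1 - 2 * p) ^ 2 / (p * (1 - p))) := by
      field_simp
      ring
    rw [this]
    exact neg_nonpos.2 (by positivity)

/-- The entropy gain of the sum of two independent bits of biases `s` and `t`. -/
theorem biasEntropy_mul_ge {s t : ℝ} (hs : |s| ≤ 1) (ht : |t| ≤ 1) :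
    biasEntropy s + s ^ 2 * (1 - t ^ 2) / (2 * Real.log 2) ≤ biasEntropy (s * t) := by
  obtain ⟨h₁, h₂⟩ := abs_le.1 hs
  obtain ⟨h₃, h₄⟩ := abs_le.1 ht
  -- The point `(1 - s * t) / 2` averages `p = (1 - s) / 2` and `1 - p`, where the entropy is the
  -- same, with weights `(1 ± t) / 2`. The quadratic term contributes twice the variance of this
  -- two-point law, `s ^ 2 * (1 - t ^ 2) / 2`.
  have hc := concaveOn_binEntropy_add_sq.2
    (show (1 - s) / 2 ∈ Set.Icc (0 : ℝ) 1 from ⟨by linarith, by linarith⟩)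
    (show 1 - (1 - s) / 2 ∈ Set.Icc (0 : ℝ) 1 from ⟨by linarith, by linarith⟩)
    (show 0 ≤ (1 + t) / 2 by linarith) (show 0 ≤ (1 - t) / 2 by linarith) (by ring)
  simp only [smul_eq_mul, Real.binEntropy_one_sub] at hc
  have e : (1 + t) / 2 * ((1 - s) / 2) + (1 - t) / 2 * (1 - (1 - s) / 2) = (1 - s * t) / 2 := by
    ring
  rw [e] at hc
  have hlog := Real.log_pos one_lt_two
  unfold biasEntropy
  rw [← div_div, ← add_div]
  refine div_le_div_of_nonneg_right ?_ hlog.le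
  linear_combination hc

/-! ### The order of the rows -/

theorem List.map_lt_map_of_strictMono {α β : Type*} [LinearOrder α] [LinearOrder β] {f : α → β}
    (hf : StrictMono f) : ∀ {l₁ l₂ : List α}, l₁ < l₂ → l₁.map f < l₂.map f
  | _, [], h => absurd h (List.not_lt_nil _)
  | [], _ :: _, _ => List.nil_lt_cons _ _
  | a :: l₁, b :: l₂, h => by
    rw [List.cons_lt_cons_iff] at h
    rw [List.map_cons, List.map_cons, List.cons_lt_cons_iff]
    rcases h with h | ⟨rfl, h⟩
    · exact Or.inl (hf h)
    · exact Or.inr ⟨rfl, List.map_lt_map_of_strictMono hf h⟩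

/-- If the heads satisfy `a < b`, then `x` precedes both, or becomes the head only of the first list
and is below `b`, or leaves both heads in place; equal heads are passed over together. -/
theorem List.orderedInsert_lt_orderedInsert {α : Type*} [LinearOrder α] (x : α) :
    ∀ {l₁ l₂ : List α}, x ∉ l₁ → x ∉ l₂ → l₁ < l₂ →
      l₁.orderedInsert (· ≥ ·) x < l₂.orderedInsert (· ≥ ·) x
  | _, [], _, _, h => absurd h (List.not_lt_nil _)
  | [], b :: l₂, _, h₂, _ => by
    have hb : x ≠ b := fun h => h₂ (h ▸ List.mem_cons_self)
    rw [List.orderedInsert, List.orderedInsert]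
    split_ifs with h
    · exact List.cons_lt_cons_iff.2 (Or.inr ⟨rfl, List.nil_lt_cons _ _⟩)
    · exact List.cons_lt_cons_iff.2 (Or.inl (not_le.1 h))
  | a :: l₁, b :: l₂, h₁, h₂, h => by
    have ha : x ≠ a := fun h => h₁ (h ▸ List.mem_cons_self)
    have hb : x ≠ b := fun h => h₂ (h ▸ List.mem_cons_self)
    have h' := List.cons_lt_cons_iff.1 h
    rw [List.orderedInsert, List.orderedInsert]
    split_ifs with hxa hxb hxb
    · exact List.cons_lt_cons_iff.2 (Or.inr ⟨rfl, h⟩)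
    · exact List.cons_lt_cons_iff.2 (Or.inl (not_le.1 hxb))
    · rcases h' with h' | ⟨rfl, -⟩
      · exact absurd (h'.le.trans hxb) hxa
      · exact absurd hxb hxa
    · rcases h' with h' | ⟨rfl, h'⟩
      · exact List.cons_lt_cons_iff.2 (Or.inl h')
      · exact List.cons_lt_cons_iff.2 (Or.inr ⟨rfl, List.orderedInsert_lt_orderedInsert x
          (fun h => h₁ (List.mem_cons_of_mem _ h)) (fun h => h₂ (List.mem_cons_of_mem _ h)) h'⟩)

theorem Finset.sort_ge_insert {α : Type*} [LinearOrder α] {s : Finset α} {x : α} (hx : x ∉ s) :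
    (insert x s).sort (· ≥ ·) = (s.sort (· ≥ ·)).orderedInsert (· ≥ ·) x := by
  refine List.Perm.eq_of_pairwise' (r := (· ≥ ·)) (Finset.pairwise_sort _ _)
    ((Finset.pairwise_sort _ _).orderedInsert x _) ?_
  refine List.Perm.trans ?_ (List.perm_orderedInsert _ _ _).symm
  rw [← Multiset.coe_eq_coe, ← Multiset.cons_coe, Finset.sort_eq, Finset.sort_eq,
    Finset.insert_val_of_notMem hx]

theorem rowLT_map_succAbove {m : ℕ} (x : Fin (m + 1)) {A B : Finset (Fin m)} (h : rowLT A B) :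
    rowLT (A.map x.succAboveEmb) (B.map x.succAboveEmb) := by
  have key (C : Finset (Fin m)) : (C.map x.succAboveEmb).sort (· ≥ ·)
      = (C.sort (· ≥ ·)).map x.succAbove := by
    exact (Finset.map_sort (f := x.succAboveEmb) (s := C) (r := (· ≥ ·)) (r' := (· ≥ ·))
      (fun a _ b _ => by simp)).symm
  rcases h with h | ⟨h₁, h₂⟩
  · exact Or.inl (by simpa using h)
  · refine Or.inr ⟨by simpa using h₁, ?_⟩
    rw [key, key]
    exact List.map_lt_map_of_strictMono (Fin.strictMono_succAbove x) h₂

theorem rowLT_insert {m : ℕ} {x : Fin m} {A B : Finset (Fin m)} (hA : x ∉ A) (hB : x ∉ B)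
    (h : rowLT A B) : rowLT (insert x A) (insert x B) := by
  unfold rowLT
  rw [Finset.card_insert_of_notMem hA, Finset.card_insert_of_notMem hB, Finset.sort_ge_insert hA,
    Finset.sort_ge_insert hB]
  rcases h with h | ⟨h₁, h₂⟩
  · exact Or.inl (by omega)
  · exact Or.inr ⟨by omega, List.orderedInsert_lt_orderedInsert x (by simpa using hA)
      (by simpa using hB) h₂⟩

theorem rowLT_irrefl {m : ℕ} (A : Finset (Fin m)) : ¬ rowLT A A := by
  rintro (h | ⟨-, h⟩)
  · exact lt_irrefl _ h
  · exact lt_irrefl _ h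

theorem rowLT_asymm {m : ℕ} {A B : Finset (Fin m)} (h : rowLT A B) : ¬ rowLT B A := by
  rcases h with h | ⟨h₁, h₂⟩
  · rintro (h' | ⟨h', -⟩) <;> omega
  · rintro (h' | ⟨-, h'⟩)
    · omega
    · exact lt_asymm h₂ h'

theorem rowLT_trichotomy {m : ℕ} (A B : Finset (Fin m)) : rowLT A B ∨ A = B ∨ rowLT B A := by
  rcases lt_trichotomy A.card B.card with h | h | h
  · exact Or.inr (Or.inr (Or.inl h))
  · rcases lt_trichotomy (A.sort (· ≥ ·)) (B.sort (· ≥ ·)) with h' | h' | h'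
    · exact Or.inl (Or.inr ⟨h, h'⟩)
    · refine Or.inr (Or.inl ?_)
      rw [← Finset.sort_toFinset A (· ≥ ·), h', Finset.sort_toFinset]
    · exact Or.inr (Or.inr (Or.inr ⟨h.symm, h'⟩))
  · exact Or.inl (Or.inl h)

/-- The order is total and asymmetric, so preserving it implies reflecting it. -/
theorem rowLT_of_insert_map_succAbove {m : ℕ} {x : Fin (m + 1)} {A B : Finset (Fin m)}
    (h : rowLT (insert x (A.map x.succAboveEmb)) (insert x (B.map x.succAboveEmb))) :
    rowLT A B := by
  have hx (C : Finset (Fin m)) : x ∉ C.map x.succAboveEmb := by simp [Fin.succAbove_ne]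
  rcases rowLT_trichotomy A B with h' | rfl | h'
  · exact h'
  · exact absurd h (rowLT_irrefl _)
  · exact absurd h (rowLT_asymm (rowLT_insert (hx B) (hx A) (rowLT_map_succAbove x h')))

/-- Cardinality alone decides: `A` has at least `B.card + 1` elements. -/
theorem rowLT_of_map_succAbove_insert {m : ℕ} {x : Fin (m + 1)} {A B : Finset (Fin m)}
    (h : rowLT (A.map x.succAboveEmb) (insert x (B.map x.succAboveEmb))) : rowLT A B := by
  have hx : x ∉ B.map x.succAboveEmb := by simp [Fin.succAbove_ne]
  unfold rowLT at h
  rw [Finset.card_insert_of_notMem hx, Finset.card_map, Finset.card_map] at h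
  exact Or.inl (by omega)

/-! ### Conditional entropy of a bit -/

section

variable {Ω : Type u} {T : Type*} (p : PMF Ω) (X : Ω → ZMod 2) (Z : Ω → T)

/-- The joint probability `P(X = x, Z = z)`. -/
noncomputable def jointProb (x : ZMod 2) (z : T) : ℝ := ((p.map fun ω => (X ω, Z ω)) (x, z)).toReal

/-- The conditional bias `P(X = 0 | Z = z) - P(X = 1 | Z = z)`. -/
noncomputable def condBias (z : T) : ℝ :=
  (jointProb p X Z 0 z - jointProb p X Z 1 z) / ((p.map Z) z).toReal

theorem ZMod.sum_univ_two {M : Type*} [AddCommMonoid M] (f : ZMod 2 → M) :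
    ∑ x, f x = f 0 + f 1 :=
  Fin.sum_univ_two f

theorem sum_map_prodMk {S : Type*} [Fintype S] (X : Ω → S) (z : T) :
    ∑ x, (p.map fun ω => (X ω, Z ω)) (x, z) = (p.map Z) z := by
  classical
  have h : p.map Z = (p.map fun ω => (X ω, Z ω)).map Prod.snd := by
    rw [PMF.map_comp]; rfl
  rw [h, PMF.map_apply, ENNReal.tsum_prod', tsum_fintype]
  refine Finset.sum_congr rfl fun x _ => ?_
  rw [tsum_eq_single z]
  · simp
  · intro z' hz
    simp [hz.symm]

theorem jointProb_nonneg (x : ZMod 2) (z : T) : 0 ≤ jointProb p X Z x z := ENNReal.toReal_nonneg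

theorem jointProb_add (z : T) :
    jointProb p X Z 0 z + jointProb p X Z 1 z = ((p.map Z) z).toReal := by
  rw [← sum_map_prodMk p Z X z, ENNReal.toReal_sum fun x _ => PMF.apply_ne_top _ _,
    ZMod.sum_univ_two]
  rfl

theorem abs_condBias_le_one (z : T) : |condBias p X Z z| ≤ 1 := by
  rw [condBias, ← jointProb_add p X, abs_div]
  have h₀ := jointProb_nonneg p X Z 0 z
  have h₁ := jointProb_nonneg p X Z 1 z
  refine div_le_one_of_le₀ ?_ (abs_nonneg _)
  rw [abs_of_nonneg (add_nonneg h₀ h₁), abs_le]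
  constructor <;> linarith

theorem hasSum_toReal (q : PMF T) : HasSum (fun z => (q z).toReal) 1 := by
  have h := (ENNReal.hasSum_toReal (f := q) (by rw [q.tsum_coe]; exact ENNReal.one_ne_top))
  rwa [← ENNReal.tsum_toReal_eq q.apply_ne_top, q.tsum_coe, ENNReal.toReal_one] at h

theorem sum_entropy_eq (z : T) :
    ∑ x, -(jointProb p X Z x z * Real.logb 2 (jointProb p X Z x z / ((p.map Z) z).toReal))
      = ((p.map Z) z).toReal * biasEntropy (condBias p X Z z) := by
  have hw := jointProb_add p X Z z
  rw [ZMod.sum_univ_two]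
  have h₀ := jointProb_nonneg p X Z 0 z
  have h₁ := jointProb_nonneg p X Z 1 z
  unfold condBias
  generalize jointProb p X Z 0 z = a at *
  generalize jointProb p X Z 1 z = b at *
  generalize ((p.map Z) z).toReal = w at *
  rcases eq_or_ne w 0 with rfl | h
  · rw [(add_eq_zero_iff_of_nonneg h₀ h₁).1 hw |>.1, (add_eq_zero_iff_of_nonneg h₀ h₁).1 hw |>.2]
    simp
  · have eb : (1 - (a - b) / w) / 2 = b / w := by
      field_simp
      linarith
    have ea : 1 - b / w = a / w := by
      field_simp
      linarith
    rw [biasEntropy, eb, Real.binEntropy, ea, Real.log_inv, Real.log_inv, Real.logb, Real.logb]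
    field_simp
    ring

theorem condEntropy_eq_tsum :
    condEntropy p X Z = ∑' z, ((p.map Z) z).toReal * biasEntropy (condBias p X Z z) :=
  tsum_congr fun z => sum_entropy_eq p X Z z

theorem entropy_term_nonneg (z : T) :
    0 ≤ ((p.map Z) z).toReal * biasEntropy (condBias p X Z z) :=
  mul_nonneg ENNReal.toReal_nonneg (biasEntropy_nonneg (abs_condBias_le_one p X Z z))

theorem entropy_term_le (z : T) :
    ((p.map Z) z).toReal * biasEntropy (condBias p X Z z) ≤ ((p.map Z) z).toReal :=
  mul_le_of_le_one_right ENNReal.toReal_nonneg (biasEntropy_le_one _)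

theorem summable_entropy_term :
    Summable fun z => ((p.map Z) z).toReal * biasEntropy (condBias p X Z z) :=
  Summable.of_nonneg_of_le (entropy_term_nonneg p X Z) (entropy_term_le p X Z)
    (hasSum_toReal (p.map Z)).summable

theorem condEntropy_nonneg : 0 ≤ condEntropy p X Z := by
  rw [condEntropy_eq_tsum]
  exact tsum_nonneg (entropy_term_nonneg p X Z)

theorem condEntropy_le_one : condEntropy p X Z ≤ 1 := by
  rw [condEntropy_eq_tsum, ← (hasSum_toReal (p.map Z)).tsum_eq]
  exact (summable_entropy_term p X Z).tsum_le_tsum (entropy_term_le p X Z)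
    (hasSum_toReal (p.map Z)).summable

/-- The information content `- log₂ P(X = x | Z = z)`. -/
noncomputable def infoContent (x : ZMod 2) (z : T) : ℝ :=
  -Real.logb 2 (jointProb p X Z x z / ((p.map Z) z).toReal)

theorem jointProb_le (x : ZMod 2) (z : T) : jointProb p X Z x z ≤ ((p.map Z) z).toReal := by
  rw [← jointProb_add p X]
  have h₀ := jointProb_nonneg p X Z 0 z
  have h₁ := jointProb_nonneg p X Z 1 z
  fin_cases x
  · exact le_add_of_nonneg_right h₁
  · exact le_add_of_nonneg_left h₀

theorem infoContent_nonneg (x : ZMod 2) (z : T) : 0 ≤ infoContent p X Z x z := by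
  have h := div_le_one_of_le₀ (jointProb_le p X Z x z) ENNReal.toReal_nonneg
  exact neg_nonneg.2 (div_nonpos_of_nonpos_of_nonneg
    (Real.log_nonpos (div_nonneg (jointProb_nonneg p X Z x z) ENNReal.toReal_nonneg) h)
    (Real.log_nonneg one_le_two))

/-- In `ℝ≥0∞` the sums can be rearranged and pushed forward without summability conditions. -/
theorem ofReal_condEntropy :
    ENNReal.ofReal (condEntropy p X Z) = ∑' z, ∑ x, (p.map fun ω => (X ω, Z ω)) (x, z) *
      ENNReal.ofReal (infoContent p X Z x z) := by
  rw [condEntropy_eq_tsum, ENNReal.ofReal_tsum_of_nonneg (entropy_term_nonneg p X Z)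
    (summable_entropy_term p X Z)]
  refine tsum_congr fun z => ?_
  rw [← sum_entropy_eq, ENNReal.ofReal_sum_of_nonneg]
  · refine Finset.sum_congr rfl fun x _ => ?_
    rw [← mul_neg, ENNReal.ofReal_mul (jointProb_nonneg p X Z x z), jointProb,
      ENNReal.ofReal_toReal (PMF.apply_ne_top _ _)]
    rfl
  · intro x _
    rw [← mul_neg]
    exact mul_nonneg (jointProb_nonneg p X Z x z) (infoContent_nonneg p X Z x z)

/-- One term of Gibbs' inequality, from `log t ≤ t - 1` at `t = (A / V) / (a / w)`. Here `a / w` and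
`A / V` play the roles of `P(x | z)` and `P(x | φ z)`; summed over `x`, the right-hand sides are at
most `0`. -/
theorem mul_log_div_sub_le {a w A V : ℝ} (ha : 0 ≤ a) (haw : a ≤ w) (haA : a ≤ A) (hAV : A ≤ V) :
    a * Real.log (A / V) - a * Real.log (a / w) ≤ w * (A / V) - a := by
  rcases ha.eq_or_lt with rfl | ha
  · have : 0 ≤ w * (A / V) := mul_nonneg haw (div_nonneg haA (haA.trans hAV))
    simpa
  have hw : 0 < w := ha.trans_le haw
  have hA : 0 < A := ha.trans_le haA
  have hV : 0 < V := hA.trans_le hAV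
  have h := mul_le_mul_of_nonneg_left
    (Real.log_le_sub_one_of_pos (div_pos (div_pos hA hV) (div_pos ha hw))) ha.le
  rw [Real.log_div (div_pos hA hV).ne' (div_pos ha hw).ne', mul_sub] at h
  refine h.trans_eq ?_
  field_simp

theorem apply_le_map_apply {α β : Type*} (q : PMF α) (f : α → β) (a : α) :
    q a ≤ (q.map f) (f a) := by
  classical
  rw [PMF.map_apply]
  refine le_trans ?_ (ENNReal.le_tsum a)
  simp

theorem tsum_map_mul {α β : Type*} (q : PMF α) (f : α → β) (g : β → ℝ≥0∞) :
    ∑' b, (q.map f) b * g b = ∑' a, q a * g (f a) := by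
  classical
  simp_rw [PMF.map_apply, ← ENNReal.tsum_mul_right]
  rw [ENNReal.tsum_comm]
  refine tsum_congr fun a => ?_
  rw [tsum_eq_single (f a)]
  · simp
  · intro b hb
    simp [hb]

theorem sum_jointProb_infoContent_le {T' : Type*} (φ : T → T') (z : T) :
    ∑ x, jointProb p X Z x z * infoContent p X Z x z
      ≤ ∑ x, jointProb p X Z x z * infoContent p X (fun ω => φ (Z ω)) x (φ z) := by
  have hle (x) : jointProb p X Z x z ≤ jointProb p X (fun ω => φ (Z ω)) x (φ z) := by
    have h := apply_le_map_apply (p.map fun ω => (X ω, Z ω)) (fun a => (a.1, φ a.2)) (x, z)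
    rw [PMF.map_comp] at h
    exact ENNReal.toReal_mono (PMF.apply_ne_top _ _) h
  have key (x) := mul_log_div_sub_le (jointProb_nonneg p X Z x z) (jointProb_le p X Z x z) (hle x)
    (jointProb_le p X (fun ω => φ (Z ω)) x (φ z))
  have hlog := Real.log_pos one_lt_two
  rw [← sub_nonneg, ← Finset.sum_sub_distrib]
  have e (x) : jointProb p X Z x z * infoContent p X (fun ω => φ (Z ω)) x (φ z)
      - jointProb p X Z x z * infoContent p X Z x z
      = -(jointProb p X Z x z * Real.log (jointProb p X (fun ω => φ (Z ω)) x (φ z) /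
          ((p.map fun ω => φ (Z ω)) (φ z)).toReal)
        - jointProb p X Z x z * Real.log (jointProb p X Z x z / ((p.map Z) z).toReal))
          / Real.log 2 := by
    simp only [infoContent, Real.logb]
    ring
  simp_rw [e]
  rw [← Finset.sum_div]
  refine div_nonneg ?_ hlog.le
  have h₀ := key 0
  have h₁ := key 1
  have hw := jointProb_add p X Z z
  have hV := jointProb_add p X (fun ω => φ (Z ω)) (φ z)
  rw [ZMod.sum_univ_two]
  have hlast : ((p.map Z) z).toReal * (jointProb p X (fun ω => φ (Z ω)) 0 (φ z) /
          ((p.map fun ω => φ (Z ω)) (φ z)).toReal)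
      + ((p.map Z) z).toReal * (jointProb p X (fun ω => φ (Z ω)) 1 (φ z) /
          ((p.map fun ω => φ (Z ω)) (φ z)).toReal) ≤ ((p.map Z) z).toReal := by
    rw [← mul_add, ← add_div, hV]
    exact mul_le_of_le_one_right ENNReal.toReal_nonneg (div_self_le_one _)
  linarith

/-- Conditioning on more reduces the entropy. -/
theorem condEntropy_le_condEntropy_comp {T' : Type*} (φ : T → T') :
    condEntropy p X Z ≤ condEntropy p X fun ω => φ (Z ω) := by
  rw [← ENNReal.ofReal_le_ofReal_iff (condEntropy_nonneg _ _ _), ofReal_condEntropy,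
    ofReal_condEntropy]
  have hsplit {T'' : Type _} (g : ZMod 2 → T'' → ℝ≥0∞) :
      ∑' z, ∑ x, g x z = ∑' a : ZMod 2 × T'', g a.1 a.2 := by
    rw [ENNReal.tsum_prod', ENNReal.tsum_comm]
    exact tsum_congr fun z => (tsum_fintype _).symm
  calc _ ≤ ∑' z, ∑ x, (p.map fun ω => (X ω, Z ω)) (x, z) *
        ENNReal.ofReal (infoContent p X (fun ω => φ (Z ω)) x (φ z)) := by
        refine ENNReal.tsum_le_tsum fun z => ?_
        have h := ENNReal.ofReal_le_ofReal (sum_jointProb_infoContent_le p X Z φ z)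
        rw [ENNReal.ofReal_sum_of_nonneg fun x _ => mul_nonneg (jointProb_nonneg p X Z x z)
            (infoContent_nonneg _ _ _ _ _), ENNReal.ofReal_sum_of_nonneg fun x _ => mul_nonneg
            (jointProb_nonneg p X Z x z) (infoContent_nonneg _ _ _ _ _)] at h
        simp_rw [ENNReal.ofReal_mul (jointProb_nonneg p X Z _ z), jointProb,
          ENNReal.ofReal_toReal (PMF.apply_ne_top _ _)] at h
        exact h
    _ = ∑' a : ZMod 2 × T, (p.map fun ω => (X ω, Z ω)) a *
        ENNReal.ofReal (infoContent p X (fun ω => φ (Z ω)) a.1 (φ a.2)) :=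
        hsplit fun x z => (p.map fun ω => (X ω, Z ω)) (x, z) *
          ENNReal.ofReal (infoContent p X (fun ω => φ (Z ω)) x (φ z))
    -- The information content depends on `z` only through `φ z`, so the expectation descends to the
    -- law of `(X, φ Z)`.
    _ = ∑' a : ZMod 2 × T', (p.map fun ω => (X ω, φ (Z ω))) a *
        ENNReal.ofReal (infoContent p X (fun ω => φ (Z ω)) a.1 a.2) := by
        rw [← tsum_map_mul (p.map fun ω => (X ω, Z ω)) (fun a => (a.1, φ a.2))
          fun a => ENNReal.ofReal (infoContent p X (fun ω => φ (Z ω)) a.1 a.2), PMF.map_comp]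
        rfl
    _ = _ := by
        rw [ENNReal.tsum_prod', ENNReal.tsum_comm]
        exact tsum_congr fun z => tsum_fintype _

end

theorem condEntropy_map {Ω Ω' : Type u} {T : Type*} (p : PMF Ω) (f : Ω → Ω') (X : Ω' → ZMod 2)
    (Z : Ω' → T) : condEntropy (p.map f) X Z = condEntropy p (X ∘ f) (Z ∘ f) := by
  unfold condEntropy
  simp_rw [PMF.map_comp]
  rfl

/-! ### The sum of two independent copies -/

/-- The law of a pair of independent random variables. -/
noncomputable def PMF.indepProd {α β : Type*} (p : PMF α) (q : PMF β) : PMF (α × β) :=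
  p.bind fun a => q.map fun b => (a, b)

theorem PMF.indepProd_apply {α β : Type*} (p : PMF α) (q : PMF β) (a : α) (b : β) :
    p.indepProd q (a, b) = p a * q b := by
  classical
  rw [PMF.indepProd, PMF.bind_apply, tsum_eq_single a]
  · rw [PMF.map_apply, tsum_eq_single b]
    · simp
    · intro b' hb
      simp [hb.symm]
  · intro a' ha
    rw [PMF.map_apply]
    simp [ha.symm]

theorem PMF.indepProd_map_fst {α β : Type*} (p : PMF α) (q : PMF β) :
    (p.indepProd q).map Prod.fst = p := by
  rw [PMF.indepProd, PMF.map_bind]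
  simp_rw [PMF.map_comp]
  have (a : α) : (Prod.fst ∘ fun b : β => (a, b)) = Function.const β a := rfl
  simp_rw [this, PMF.map_const, PMF.bind_pure]

theorem PMF.indepProd_map_map {α β γ δ : Type*} (p : PMF α) (q : PMF β) (f : α → γ) (g : β → δ) :
    (p.indepProd q).map (fun a => (f a.1, g a.2)) = (p.map f).indepProd (q.map g) := by
  simp_rw [PMF.indepProd, PMF.map_bind, PMF.bind_map, PMF.map_comp]
  rfl

section

variable {Ω : Type u} {T : Type*} (p : PMF Ω) (X : Ω → ZMod 2) (Z : Ω → T)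

theorem jointProb_indepProd_sum (x : ZMod 2) (z : T × T) :
    jointProb (p.indepProd p) (fun ω => X ω.1 + X ω.2) (fun ω => (Z ω.1, Z ω.2)) x z
      = jointProb p X Z 0 z.1 * jointProb p X Z x z.2
        + jointProb p X Z 1 z.1 * jointProb p X Z (x + 1) z.2 := by
  classical
  have h : (p.indepProd p).map (fun ω => (X ω.1 + X ω.2, (Z ω.1, Z ω.2)))
      = ((p.map fun ω => (X ω, Z ω)).indepProd (p.map fun ω => (X ω, Z ω))).map
        (fun a => (a.1.1 + a.2.1, (a.1.2, a.2.2))) := by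
    rw [← PMF.indepProd_map_map, PMF.map_comp]
    rfl
  obtain ⟨z₁, z₂⟩ := z
  have key : ((p.indepProd p).map (fun ω => (X ω.1 + X ω.2, (Z ω.1, Z ω.2)))) (x, (z₁, z₂))
      = ∑ x₁, (p.map fun ω => (X ω, Z ω)) (x₁, z₁) * (p.map fun ω => (X ω, Z ω)) (x + x₁, z₂) := by
    rw [h, PMF.map_apply, ENNReal.tsum_prod', ENNReal.tsum_prod', tsum_fintype]
    refine Finset.sum_congr rfl fun x₁ _ => ?_
    rw [tsum_eq_single z₁]
    · rw [tsum_eq_single (x + x₁, z₂)]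
      · have : x = x₁ + (x + x₁) := by
          revert x x₁; decide
        rw [if_pos (by rw [← this]), PMF.indepProd_apply]
      · rintro ⟨x₂, z⟩ hne
        refine if_neg fun h => hne ?_
        simp only [Prod.mk.injEq] at h
        have h' : ∀ a b c : ZMod 2, a = b + c → c = a + b := by decide
        rw [← h' _ _ _ h.1, h.2.2]
    · intro z hz
      refine ENNReal.tsum_eq_zero.2 fun b => if_neg ?_
      simp [hz.symm]
  rw [jointProb, key, ENNReal.toReal_sum fun x _ =>
    ENNReal.mul_ne_top (PMF.apply_ne_top _ _) (PMF.apply_ne_top _ _)]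
  simp_rw [ENNReal.toReal_mul]
  rw [ZMod.sum_univ_two, add_zero]
  rfl

theorem map_indepProd_apply (z : T × T) :
    (((p.indepProd p).map fun ω => (Z ω.1, Z ω.2)) z).toReal
      = ((p.map Z) z.1).toReal * ((p.map Z) z.2).toReal := by
  rw [PMF.indepProd_map_map, PMF.indepProd_apply, ENNReal.toReal_mul]

/-- The bias is the conditional expectation of `(-1) ^ X`, which is multiplicative over independent
bits. -/
theorem condBias_indepProd_sum (z : T × T) :
    condBias (p.indepProd p) (fun ω => X ω.1 + X ω.2) (fun ω => (Z ω.1, Z ω.2)) z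
      = condBias p X Z z.1 * condBias p X Z z.2 := by
  rw [condBias, condBias, condBias, div_mul_div_comm, map_indepProd_apply,
    jointProb_indepProd_sum, jointProb_indepProd_sum]
  congr 1
  rw [show (1 + 1 : ZMod 2) = 0 from rfl, show (0 + 1 : ZMod 2) = 1 from rfl]
  ring

theorem summable_condBias_sq : Summable fun z => ((p.map Z) z).toReal * condBias p X Z z ^ 2 :=
  Summable.of_nonneg_of_le (fun _ => mul_nonneg ENNReal.toReal_nonneg (sq_nonneg _))
    (fun z => mul_le_of_le_one_right ENNReal.toReal_nonneg
      ((sq_le_one_iff_abs_le_one _).2 (abs_condBias_le_one p X Z z)))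
    (hasSum_toReal (p.map Z)).summable

/-- The second moment of the conditional bias. -/
noncomputable def biasMoment : ℝ := ∑' z, ((p.map Z) z).toReal * condBias p X Z z ^ 2

theorem condEntropy_add_le_condEntropy_indepProd :
    condEntropy p X Z + biasMoment p X Z * (1 - biasMoment p X Z) / (2 * Real.log 2)
      ≤ condEntropy (p.indepProd p) (fun ω => X ω.1 + X ω.2) (fun ω => (Z ω.1, Z ω.2)) := by
  have hw := hasSum_toReal (p.map Z)
  have hh := summable_entropy_term p X Z
  have hq := summable_condBias_sq p X Z
  have hr := hw.summable.sub hq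
  have hprod₁ := summable_mul_of_summable_norm hh.norm hw.summable.norm
  have hprod₂ := summable_mul_of_summable_norm hq.norm hr.norm
  -- The pair of observations has a product law, so averaging `biasEntropy_mul_ge` factors into `H *
  -- 1` and `q * (1 - q)`.
  have e₁ := tsum_mul_tsum_of_summable_norm hh.norm hw.summable.norm
  have e₂ := tsum_mul_tsum_of_summable_norm hq.norm hr.norm
  rw [hw.summable.tsum_sub hq] at e₂
  rw [hw.tsum_eq] at e₁ e₂
  rw [condEntropy_eq_tsum p, condEntropy_eq_tsum (p.indepProd p), biasMoment, e₂, ← mul_one (tsum _),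
    e₁, ← tsum_div_const, ← hprod₁.tsum_add (hprod₂.div_const _)]
  refine (hprod₁.add (hprod₂.div_const _)).tsum_le_tsum (fun z => ?_)
    (summable_entropy_term (p.indepProd p) _ _)
  rw [condBias_indepProd_sum, map_indepProd_apply]
  have h := mul_le_mul_of_nonneg_left (biasEntropy_mul_ge (abs_condBias_le_one p X Z z.1)
    (abs_condBias_le_one p X Z z.2)) (mul_nonneg (ENNReal.toReal_nonneg (a := (p.map Z) z.1))
      (ENNReal.toReal_nonneg (a := (p.map Z) z.2)))
  refine le_trans (le_of_eq ?_) h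
  ring

theorem sq_lt_biasMoment {ε : ℝ} (hε : 0 < ε) (h : condEntropy p X Z < 1 - ε) :
    ε ^ 2 < biasMoment p X Z := by
  have hw := hasSum_toReal (p.map Z)
  have hq := summable_condBias_sq p X Z
  -- The free parameter of `le_biasEntropy_of_pos` is taken to be `ε`.
  have hl : 1 - ε / 2 - biasMoment p X Z / (2 * ε) ≤ condEntropy p X Z := by
    have hs := ((hw.mul_left (1 - ε / 2)).sub (hq.hasSum.div_const (2 * ε)))
    rw [mul_one] at hs
    rw [condEntropy_eq_tsum]
    refine hasSum_le (fun z => ?_) hs (summable_entropy_term p X Z).hasSum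
    have := mul_le_mul_of_nonneg_left (le_biasEntropy_of_pos (abs_condBias_le_one p X Z z) hε)
      (ENNReal.toReal_nonneg (a := (p.map Z) z))
    refine le_trans (le_of_eq ?_) this
    field_simp
    ring
  have : ε / 2 < biasMoment p X Z / (2 * ε) := by linarith
  rw [lt_div_iff₀ (by positivity)] at this
  linarith

theorem sq_lt_one_sub_biasMoment {ε : ℝ} (hε : 0 < ε) (h : ε < condEntropy p X Z) :
    (ε * Real.log 2) ^ 2 < 1 - biasMoment p X Z := by
  have hlog := Real.log_pos one_lt_two
  -- With this parameter the averaged bound turns `ε < H` into `2 * l < l + (1 - q) / l`.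
  set l := ε * Real.log 2 with hl
  have hl0 : 0 < l := mul_pos hε hlog
  have hw := hasSum_toReal (p.map Z)
  have hq := summable_condBias_sq p X Z
  have hu : condEntropy p X Z ≤ (l + (1 - biasMoment p X Z) / l) / (2 * Real.log 2) := by
    have hs := ((hw.mul_left l).add ((hw.sub hq.hasSum).div_const l)).div_const (2 * Real.log 2)
    rw [mul_one] at hs
    rw [condEntropy_eq_tsum]
    refine hasSum_le (fun z => ?_) (summable_entropy_term p X Z).hasSum hs
    have := mul_le_mul_of_nonneg_left (biasEntropy_le_of_pos (abs_condBias_le_one p X Z z) hl0)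
      (ENNReal.toReal_nonneg (a := (p.map Z) z))
    refine this.trans_eq ?_
    ring
  have h' := h.trans_le hu
  rw [lt_div_iff₀ (by positivity)] at h'
  have : l < (1 - biasMoment p X Z) / l := by linarith
  rw [lt_div_iff₀ hl0] at this
  linarith

theorem condEntropy_indepProd_gap {ε : ℝ} (hε : 0 < ε) (h₀ : ε < condEntropy p X Z)
    (h₁ : condEntropy p X Z < 1 - ε) :
    condEntropy p X Z + ε ^ 2 * (ε * Real.log 2) ^ 2 / (2 * Real.log 2)
      ≤ condEntropy (p.indepProd p) (fun ω => X ω.1 + X ω.2) (fun ω => (Z ω.1, Z ω.2)) := by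
  refine le_trans ?_ (condEntropy_add_le_condEntropy_indepProd p X Z)
  have hlog := Real.log_pos one_lt_two
  have hq := sq_lt_biasMoment p X Z hε h₁
  have hr := sq_lt_one_sub_biasMoment p X Z hε h₀
  gcongr
  exact (sq_nonneg _).trans hq.le

theorem condEntropy_le_condEntropy_indepProd :
    condEntropy p X Z
      ≤ condEntropy (p.indepProd p) (fun ω => X ω.1 + X ω.2) (fun ω => (Z ω.1, Z ω.2)) := by
  refine le_trans (le_add_of_nonneg_right ?_) (condEntropy_add_le_condEntropy_indepProd p X Z)
  have hq : biasMoment p X Z ≤ 1 := by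
    have hw := hasSum_toReal (p.map Z)
    refine hasSum_le (fun z => ?_) (summable_condBias_sq p X Z).hasSum hw
    exact mul_le_of_le_one_right ENNReal.toReal_nonneg
      ((sq_le_one_iff_abs_le_one _).2 (abs_condBias_le_one p X Z z))
  have hq' : 0 ≤ biasMoment p X Z :=
    tsum_nonneg fun _ => mul_nonneg ENNReal.toReal_nonneg (sq_nonneg _)
  exact div_nonneg (mul_nonneg hq' (by linarith)) (by positivity)

end

/-- The image law is pointwise at most `q` and both have total mass `1`, so they agree; surjectivity
of `f` need not be checked. -/
theorem PMF.map_eq_of_injective {α β : Type*} {p : PMF α} {q : PMF β} {f : α → β}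
    (hf : Function.Injective f) (h : ∀ a, q (f a) = p a) : p.map f = q := by
  classical
  have hle (b : β) : (p.map f) b ≤ q b := by
    rw [PMF.map_apply]
    by_cases hb : ∃ a, f a = b
    · obtain ⟨a, rfl⟩ := hb
      rw [tsum_eq_single a fun a' ha => if_neg fun e => ha (hf e).symm, if_pos rfl, h]
    · rw [ENNReal.tsum_eq_zero.2 fun a => if_neg fun e => hb ⟨a, e.symm⟩]
      exact zero_le
  by_contra hne
  obtain ⟨b, hb⟩ : ∃ b, (p.map f) b ≠ q b := by
    by_contra! hall
    exact hne (PMF.ext hall)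
  have := ENNReal.tsum_lt_tsum (PMF.tsum_coe_ne_top (p.map f)) hle (lt_of_le_of_ne (hle b) hb)
  rw [PMF.tsum_coe, PMF.tsum_coe] at this
  exact lt_irrefl _ this

theorem condEntropy_le_of_factorsThrough {Ω : Type u} {T T' : Type*} (p : PMF Ω)
    (X : Ω → ZMod 2) (Z : Ω → T) (Z' : Ω → T') (h : Function.FactorsThrough Z' Z) :
    condEntropy p X Z ≤ condEntropy p X Z' := by
  obtain ⟨ω, -⟩ := p.support_nonempty
  -- The default value `Z' ω` is taken only off the range of `Z`.
  have e : (fun ω' => Function.extend Z Z' (fun _ => Z' ω) (Z ω')) = Z' :=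
    funext fun ω' => h.extend_apply _ ω'
  exact (condEntropy_le_condEntropy_comp p X Z (Function.extend Z Z' fun _ => Z' ω)).trans_eq
    (congrArg _ e)

/-! ### Splitting off one variable -/

section

variable {m : ℕ} (x : Fin (m + 1))

theorem exists_eq_map_succAbove {B : Finset (Fin (m + 1))} (h : x ∉ B) :
    ∃ C : Finset (Fin m), B = C.map x.succAboveEmb := by
  refine ⟨Finset.univ.filter fun i => x.succAbove i ∈ B, ?_⟩
  ext i
  rcases Fin.eq_self_or_eq_succAbove x i with rfl | ⟨j, rfl⟩
  · simp [h, Fin.succAbove_ne]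
  · simp

theorem exists_eq_map_or_eq_insert (B : Finset (Fin (m + 1))) :
    ∃ C : Finset (Fin m),
      B = C.map x.succAboveEmb ∨ B = insert x (C.map x.succAboveEmb) := by
  by_cases h : x ∈ B
  · obtain ⟨C, hC⟩ := exists_eq_map_succAbove x (Finset.notMem_erase x B)
    exact ⟨C, Or.inr (by rw [← hC, Finset.insert_erase h])⟩
  · obtain ⟨C, hC⟩ := exists_eq_map_succAbove x h
    exact ⟨C, Or.inl hC⟩

theorem exists_eq_insertNth (z : Fin (m + 1) → ZMod 2) :
    ∃ z' : Fin m → ZMod 2, z = x.insertNth (α := fun _ => ZMod 2) 0 z' ∨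
      z = x.insertNth (α := fun _ => ZMod 2) 1 z' := by
  have hx : z x = 0 ∨ z x = 1 := by
    generalize z x = a
    revert a
    decide
  refine ⟨x.removeNth z, hx.imp (fun h => ?_) fun h => ?_⟩ <;>
  · rw [← h, Fin.insertNth_self_removeNth]

theorem sum_finset_fin_succ {M : Type*} [AddCommMonoid M] (f : Finset (Fin (m + 1)) → M) :
    ∑ B, f B = ∑ C : Finset (Fin m), f (C.map x.succAboveEmb)
      + ∑ C : Finset (Fin m), f (insert x (C.map x.succAboveEmb)) := by
  have hx (C : Finset (Fin m)) : x ∉ C.map x.succAboveEmb := by simp [Fin.succAbove_ne]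
  rw [← Finset.sum_filter_not_add_sum_filter Finset.univ (fun B => x ∈ B) f]
  congr 1
  · symm
    refine Finset.sum_bij (fun C _ => C.map x.succAboveEmb) (fun C _ => by simp)
      (fun C _ D _ h => Finset.map_injective _ h) (fun B hB => ?_) fun _ _ => rfl
    obtain ⟨C, hC⟩ := exists_eq_map_succAbove x (Finset.mem_filter.1 hB).2
    exact ⟨C, Finset.mem_univ _, hC.symm⟩
  · symm
    refine Finset.sum_bij (fun C _ => insert x (C.map x.succAboveEmb)) (fun C _ => by simp)
      (fun C _ D _ h => ?_) (fun B hB => ?_) fun _ _ => rfl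
    · have := congrArg (fun s => s.erase x) h
      simp only [Finset.erase_insert (hx _)] at this
      exact Finset.map_injective _ this
    · obtain ⟨C, rfl | hC⟩ := exists_eq_map_or_eq_insert x B
      · exact absurd (Finset.mem_filter.1 hB).2 (hx C)
      · exact ⟨C, Finset.mem_univ _, hC.symm⟩

theorem prod_insertNth {M : Type*} [CommMonoid M] (f : (Fin (m + 1) → ZMod 2) → M) :
    ∏ z, f z = (∏ z, f (x.insertNth (α := fun _ => ZMod 2) 0 z))
      * ∏ z, f (x.insertNth (α := fun _ => ZMod 2) 1 z) := by
  rw [← (Fin.insertNthEquiv (fun _ => ZMod 2) x).prod_comp, Fintype.prod_prod_type]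
  exact Fin.prod_univ_two fun b : Fin 2 =>
    ∏ z, f (x.insertNth (α := fun _ => ZMod 2) (b : ZMod 2) z)

/-- The coefficients of the restriction of `∑_B U_B v(B)` to `z_x = 0`. -/
def restrictZero (U : Finset (Fin (m + 1)) → ZMod 2) (C : Finset (Fin m)) : ZMod 2 :=
  U (C.map x.succAboveEmb)

/-- The coefficients of the restriction of `∑_B U_B v(B)` to `z_x = 1`. -/
def restrictOne (U : Finset (Fin (m + 1)) → ZMod 2) (C : Finset (Fin m)) : ZMod 2 :=
  U (C.map x.succAboveEmb) + U (insert x (C.map x.succAboveEmb))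

theorem rmRow_map_insertNth (C : Finset (Fin m)) (b : ZMod 2) (z : Fin m → ZMod 2) :
    rmRow (C.map x.succAboveEmb) (x.insertNth (α := fun _ => ZMod 2) b z) = rmRow C z := by
  simp [rmRow]

theorem rmRow_insert_insertNth (C : Finset (Fin m)) (b : ZMod 2) (z : Fin m → ZMod 2) :
    rmRow (insert x (C.map x.succAboveEmb)) (x.insertNth (α := fun _ => ZMod 2) b z)
      = b * rmRow C z := by
  have hx : x ∉ C.map x.succAboveEmb := by simp [Fin.succAbove_ne]
  rw [← rmRow_map_insertNth x C b z, rmRow, Finset.prod_insert hx, Fin.insertNth_apply_same, rmRow]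

theorem rmEncode_insertNth_zero (U : Finset (Fin (m + 1)) → ZMod 2) (z : Fin m → ZMod 2) :
    rmEncode U (x.insertNth (α := fun _ => ZMod 2) 0 z) = rmEncode (restrictZero x U) z := by
  rw [rmEncode, sum_finset_fin_succ x]
  simp only [rmRow_map_insertNth, rmRow_insert_insertNth, zero_mul, mul_zero,
    Finset.sum_const_zero, add_zero]
  rfl

theorem rmEncode_insertNth_one (U : Finset (Fin (m + 1)) → ZMod 2) (z : Fin m → ZMod 2) :
    rmEncode U (x.insertNth (α := fun _ => ZMod 2) 1 z) = rmEncode (restrictOne x U) z := by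
  rw [rmEncode, sum_finset_fin_succ x]
  simp only [rmRow_map_insertNth, rmRow_insert_insertNth, one_mul, ← Finset.sum_add_distrib,
    ← add_mul]
  rfl

theorem rmLaw_apply {Y : Type u} (W : ZMod 2 → PMF Y) (m : ℕ) (U : Finset (Fin m) → ZMod 2)
    (y : (Fin m → ZMod 2) → Y) :
    rmLaw W m (U, y)
      = (Fintype.card (Finset (Fin m) → ZMod 2) : ℝ≥0∞)⁻¹ * ∏ z, W (rmEncode U z) (y z) := by
  classical
  rw [rmLaw, PMF.bind_apply, tsum_eq_single U]
  · rw [PMF.uniformOfFintype_apply, PMF.map_apply, tsum_eq_single y]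
    · rw [if_pos rfl]
      rfl
    · intro y' hy
      simp [hy.symm]
  · intro U' hU
    rw [PMF.map_apply]
    simp [hU.symm]

/-- The two restrictions of the coefficients and of the outputs to `z_x = 0` and `z_x = 1`. -/
def rmSplit {Y : Type u} (ω : (Finset (Fin (m + 1)) → ZMod 2) × ((Fin (m + 1) → ZMod 2) → Y)) :
    ((Finset (Fin m) → ZMod 2) × ((Fin m → ZMod 2) → Y)) ×
      ((Finset (Fin m) → ZMod 2) × ((Fin m → ZMod 2) → Y)) :=
  ((restrictZero x ω.1, fun z => ω.2 (x.insertNth (α := fun _ => ZMod 2) 0 z)),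
    (restrictOne x ω.1, fun z => ω.2 (x.insertNth (α := fun _ => ZMod 2) 1 z)))

theorem rmSplit_injective {Y : Type u} : Function.Injective (rmSplit (Y := Y) x) := by
  rintro ⟨U, y⟩ ⟨U', y'⟩ h
  simp only [rmSplit, Prod.mk.injEq] at h
  obtain ⟨⟨hU₀, hy₀⟩, hU₁, hy₁⟩ := h
  refine Prod.ext (funext fun B => ?_) (funext fun z => ?_)
  · obtain ⟨C, rfl | rfl⟩ := exists_eq_map_or_eq_insert x B
    · exact congrFun hU₀ C
    · have h₀ := congrFun hU₀ C
      have h₁ := congrFun hU₁ C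
      simp only [restrictZero, restrictOne] at h₀ h₁
      rw [h₀] at h₁
      exact add_left_cancel h₁
  · obtain ⟨z, rfl | rfl⟩ := exists_eq_insertNth x z
    · exact congrFun hy₀ z
    · exact congrFun hy₁ z

/-- The two restrictions are independent copies of the code with one variable less. -/
theorem rmLaw_map_rmSplit {Y : Type u} (W : ZMod 2 → PMF Y) :
    (rmLaw W (m + 1)).map (rmSplit x) = (rmLaw W m).indepProd (rmLaw W m) := by
  refine PMF.map_eq_of_injective (rmSplit_injective x) ?_
  rintro ⟨U, y⟩
  -- The normalising constants agree: `2 ^ 2 ^ (m + 1) = (2 ^ 2 ^ m) ^ 2`.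
  have hcard : (Fintype.card (Finset (Fin (m + 1)) → ZMod 2) : ℝ≥0∞)
      = Fintype.card (Finset (Fin m) → ZMod 2) * Fintype.card (Finset (Fin m) → ZMod 2) := by
    rw [← Nat.cast_mul]
    congr 1
    simp only [Fintype.card_fun, ZMod.card, Fintype.card_finset, Fintype.card_fin]
    rw [← pow_add, pow_succ, mul_two]
  rw [rmSplit, PMF.indepProd_apply, rmLaw_apply, rmLaw_apply, rmLaw_apply, hcard,
    prod_insertNth x, ENNReal.mul_inv (Or.inr (ENNReal.natCast_ne_top _))
    (Or.inl (ENNReal.natCast_ne_top _))]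
  simp only [rmEncode_insertNth_zero, rmEncode_insertNth_one]
  ring

/-! ### One step of a chain -/

variable {Y : Type u} (W : ZMod 2 → PMF Y) (A : Finset (Fin m))

/-- The outputs with `z_x = 0` and the earlier coefficients without `x` are part of what is observed
in the larger code. -/
theorem rmEntropy_map_le : rmEntropy W (m + 1) (A.map x.succAboveEmb) ≤ rmEntropy W m A := by
  have h : rmLaw W m = (rmLaw W (m + 1)).map fun ω => (rmSplit x ω).1 := by
    rw [← PMF.indepProd_map_fst (rmLaw W m) (rmLaw W m), ← rmLaw_map_rmSplit x, PMF.map_comp]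
    rfl
  rw [rmEntropy, rmEntropy, h, condEntropy_map]
  refine condEntropy_le_of_factorsThrough _ _ _ _ fun ω ω' hω => ?_
  obtain ⟨hy, hU⟩ := Prod.mk.injEq _ _ _ _ ▸ hω
  refine Prod.ext (funext fun z => congrFun hy _) (funext fun B => ?_)
  exact congrFun hU ⟨B.1.map x.succAboveEmb, rowLT_map_succAbove x B.2⟩

/-- In characteristic two, the coefficient at `insert x A` is the sum of the two restricted
coefficients at `A`. Every row before `insert x A` comes from some `C` before `A`, with or without
`x`, so its coefficient can be recovered from the two copies. -/
theorem condEntropy_indepProd_le_rmEntropy_insert :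
    condEntropy ((rmLaw W m).indepProd (rmLaw W m)) (fun ω => ω.1.1 A + ω.2.1 A)
      (fun ω => ((ω.1.2, fun B : {B : Finset (Fin m) // rowLT B A} => ω.1.1 B.1),
        (ω.2.2, fun B : {B : Finset (Fin m) // rowLT B A} => ω.2.1 B.1)))
      ≤ rmEntropy W (m + 1) (insert x (A.map x.succAboveEmb)) := by
  rw [← rmLaw_map_rmSplit x, condEntropy_map, rmEntropy]
  have hX : ((fun ω : ((Finset (Fin m) → ZMod 2) × ((Fin m → ZMod 2) → Y)) ×
      ((Finset (Fin m) → ZMod 2) × ((Fin m → ZMod 2) → Y)) => ω.1.1 A + ω.2.1 A) ∘ rmSplit x)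
      = fun ω => ω.1 (insert x (A.map x.succAboveEmb)) := by
    funext ω
    simp only [Function.comp_apply, rmSplit, restrictZero, restrictOne]
    rw [← add_assoc, CharTwo.add_self_eq_zero, zero_add]
  rw [hX]
  refine condEntropy_le_of_factorsThrough _ _ _ _ fun ω ω' hω => ?_
  simp only [Function.comp_apply, rmSplit, Prod.mk.injEq] at hω
  obtain ⟨⟨hy₀, hU₀⟩, hy₁, hU₁⟩ := hω
  refine Prod.ext (funext fun z => ?_) (funext fun ⟨B, hB⟩ => ?_)
  · obtain ⟨z, rfl | rfl⟩ := exists_eq_insertNth x z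
    · exact congrFun hy₀ z
    · exact congrFun hy₁ z
  · obtain ⟨C, rfl | rfl⟩ := exists_eq_map_or_eq_insert x B
    · exact congrFun hU₀ ⟨C, rowLT_of_map_succAbove_insert hB⟩
    · have h₀ := congrFun hU₀ ⟨C, rowLT_of_insert_map_succAbove hB⟩
      have h₁ := congrFun hU₁ ⟨C, rowLT_of_insert_map_succAbove hB⟩
      simp only [restrictZero, restrictOne] at h₀ h₁
      rw [h₀] at h₁
      exact add_left_cancel h₁

theorem rmEntropy_map_le_rmEntropy_insert :
    rmEntropy W (m + 1) (A.map x.succAboveEmb)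
      ≤ rmEntropy W (m + 1) (insert x (A.map x.succAboveEmb)) :=
  (rmEntropy_map_le x W A).trans ((condEntropy_le_condEntropy_indepProd _ _ _).trans
    (condEntropy_indepProd_le_rmEntropy_insert x W A))

/-- A lower bound for the growth of the conditional entropy along a chain. -/
noncomputable def entropyGap (ε : ℝ) : ℝ :=
  min (ε / 2) ((ε / 2) ^ 2 * (ε / 2 * Real.log 2) ^ 2 / (2 * Real.log 2))

theorem entropyGap_pos {ε : ℝ} (hε : 0 < ε) : 0 < entropyGap ε := by
  have hlog := Real.log_pos one_lt_two
  exact lt_min (half_pos hε) (by positivity)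

theorem rmEntropy_map_add_entropyGap_le {ε : ℝ} (hε : 0 < ε)
    (h₀ : ε < rmEntropy W (m + 1) (A.map x.succAboveEmb))
    (h₁ : rmEntropy W (m + 1) (A.map x.succAboveEmb) < 1 - ε) :
    rmEntropy W (m + 1) (A.map x.succAboveEmb) + entropyGap ε
      ≤ rmEntropy W (m + 1) (insert x (A.map x.succAboveEmb)) := by
  have hle := rmEntropy_map_le x W A
  refine le_trans ?_ (condEntropy_indepProd_le_rmEntropy_insert x W A)
  -- Passing to `m` variables may push the entropy close to `1`, where the gap lemma is unavailable;
  -- that passage has then already gained `ε / 2`.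
  rcases lt_or_ge (rmEntropy W m A) (1 - ε / 2) with h | h
  · exact (add_le_add hle (min_le_right _ _)).trans
      (condEntropy_indepProd_gap _ _ _ (half_pos hε)
        (((half_lt_self hε).trans h₀).trans_le hle) h)
  · have h' : rmEntropy W m A ≤ _ := condEntropy_le_condEntropy_indepProd _ _ _
    have := min_le_left (ε / 2) ((ε / 2) ^ 2 * (ε / 2 * Real.log 2) ^ 2 / (2 * Real.log 2))
    refine le_trans ?_ h'
    unfold entropyGap
    linarith

end

/-! ### Counting along a chain -/

theorem ncard_le_of_forall_add_le {n : ℕ} {δ : ℝ} (hδ : 0 < δ) (f : Fin (n + 1) → ℝ)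
    (S : Set (Fin (n + 1))) (hf₀ : 0 ≤ f 0) (hf₁ : f (Fin.last n) ≤ 1)
    (hmono : ∀ i : Fin n, f i.castSucc ≤ f i.succ)
    (hgap : ∀ i : Fin n, i.castSucc ∈ S → f i.castSucc + δ ≤ f i.succ) :
    (S.ncard : ℝ) ≤ 1 / δ + 1 := by
  -- Each index of `S` strictly below `i` has already contributed a jump of `δ` to `f i`.
  have key (i : Fin (n + 1)) : δ * ((S ∩ Set.Iio i).ncard : ℝ) ≤ f i := by
    induction i using Fin.induction with
    | zero =>
      have : Set.Iio (0 : Fin (n + 1)) = ∅ := by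
        ext i
        simp
      simpa [this] using hf₀
    | succ i ih =>
      have hI : Set.Iio i.succ = insert i.castSucc (Set.Iio i.castSucc) := by
        ext j
        simp only [Set.mem_Iio, Set.mem_insert_iff, Fin.lt_def, Fin.ext_iff, Fin.val_succ,
          Fin.val_castSucc]
        omega
      by_cases hi : i.castSucc ∈ S
      · rw [hI, Set.inter_insert_of_mem hi, Set.ncard_insert_of_notMem (by simp)]
        push_cast
        linarith [hgap i hi]
      · rw [hI, Set.inter_insert_of_notMem hi]
        exact ih.trans (hmono i)
  have hlast := (key (Fin.last n)).trans hf₁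
  -- The last index has no successor, hence no jump; it accounts for the `+ 1`.
  have hS : S ⊆ insert (Fin.last n) (S ∩ Set.Iio (Fin.last n)) := by
    intro i hi
    rcases (Fin.le_last i).eq_or_lt with h | h
    · exact Or.inl h
    · exact Or.inr ⟨hi, h⟩
  have hcard : S.ncard ≤ (S ∩ Set.Iio (Fin.last n)).ncard + 1 :=
    (Set.ncard_le_ncard hS (Set.toFinite _)).trans (Set.ncard_insert_le _ _)
  have hcard' : (S.ncard : ℝ) ≤ ((S ∩ Set.Iio (Fin.last n)).ncard : ℝ) + 1 := by
    exact_mod_cast hcard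
  rw [mul_comm, ← le_div_iff₀ hδ] at hlast
  linarith

theorem IsIncreasingChain.exists_eq_insert {m : ℕ} {A : Fin (m + 2) → Finset (Fin (m + 1))}
    (hA : IsIncreasingChain A) (i : Fin (m + 1)) :
    ∃ (x : Fin (m + 1)) (C : Finset (Fin m)), A i.castSucc = C.map x.succAboveEmb ∧
      A i.succ = insert x (C.map x.succAboveEmb) := by
  have hcard : (A i.castSucc).card + 1 = (A i.succ).card := by
    rw [hA.2, hA.2, Fin.val_castSucc, Fin.val_succ]
  obtain ⟨x, hx, h⟩ := Finset.exists_eq_insert_iff.2 ⟨hA.1 i.castSucc_lt_succ.le, hcard⟩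
  obtain ⟨C, hC⟩ := exists_eq_map_succAbove x hx
  exact ⟨x, C, hC, by rw [← h, hC]⟩

theorem mainTheorem5 (ε : ℝ) (hε : 0 < ε) :
    ∃ D : ℝ, ∀ (Y : Type u) (W : ZMod 2 → PMF Y), IsBMS W →
      ∀ m : ℕ, 0 < m → ∀ A : Fin (m + 1) → Finset (Fin m), IsIncreasingChain A →
        ({i : Fin (m + 1) | ε < rmEntropy W m (A i) ∧ rmEntropy W m (A i) < 1 - ε}.ncard : ℝ)
          ≤ D := by
  refine ⟨1 / entropyGap ε + 1, fun Y W _ m hm A hA => ?_⟩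
  -- Removing a variable requires a number of variables of the form `m + 1`.
  obtain ⟨m, rfl⟩ := Nat.exists_eq_add_one.2 hm
  refine ncard_le_of_forall_add_le (entropyGap_pos hε) (fun i => rmEntropy W (m + 1) (A i)) _
    (condEntropy_nonneg _ _ _) (condEntropy_le_one _ _ _) (fun i => ?_) fun i hi => ?_
  · obtain ⟨x, C, h₀, h₁⟩ := hA.exists_eq_insert i
    simp only [h₀, h₁]
    exact rmEntropy_map_le_rmEntropy_insert x W C
  · obtain ⟨x, C, h₀, h₁⟩ := hA.exists_eq_insert i
    simp only [Set.mem_ofPred_eq, h₀] at hi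
    simp only [h₀, h₁]
    exact rmEntropy_map_add_entropyGap_le x W C hε hi.1 hi.2
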